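/- For real $p,q$ and $x\in(0,\pi/2)$ put $S_p(x)=\frac{1-(\sin x/x)^p}{p}$ if $p\neq 0$, $S_0(x)=-\ln\frac{\sin x}{x}$; $C_q(x)=\frac{1-\cos^q x}{q}$ if $q\ne 0$, $C_0(x)=-\ln\cos x$; and $D_{p,q}(x)=\frac{S_p(x)}{C_q(x)}-\frac13$. Let $E=\{(p,q)\in\mathbb R^2 : p\le 0 \text{ or } 0<p\le 3q\}$, and for $t\in(0,1)$ and $(p,q)\in E$ let $$M(t;p,q)=\begin{cases}\left(1-\frac{p}{3q}+\frac{p}{3q}t^q\right)^{1/p} & pq\ne 0,\\ \exp\frac{t^q-1}{3q} & p=0,\ q\neq 0,\\ \left(1+\frac p3\ln t\right)^{1/p} & p<0,\ q=0,\\ t^{1/3} & p=q=0.\end{cases}$$ For every $q>0$ the equation $D_{p,q}(\pi/2^-)=0$ (where $D_{p,q}(\pi/2^-)=\lim_{x\to \pi/2^-}D_{p,q}(x)$) has a unique real root $p=p(q)$, and $q\mapsto p(q)$, $(0,\infty)\to\mathbb R$, is the inverse function of $q(p)=\frac{p}{3(1-(2/\pi)^p)}$ $(p\ne0)$, $q(0)=-\frac{1}{3\ln(2/\pi)}$,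 $\mathbb R\to(0,\infty)$. Let $(p_1,q),(p_2,q)\in E$ (in (iii) only $(p_1,q)\in E$). (i) If $q\ge 1$, then the double inequality $$M(\cos x;p_1,q)<\frac{\sin x}{x}<M(\cos x;p_2,q)\qquad (*)$$ holds for all $x\in(0,\pi/2)$ if and only if $p_1\ge p(q)$ and $p_2\le 3q-\frac85$. (ii) If $0<q\le \frac{34}{35}$, then $(*)$ holds for all $x\in(0,\pi/2)$ if and only if $p_1\ge 3q-\frac85$ and $p_2\le p(q)$. (iii) If $q\le 0$, then the first inequality in $(*)$ holds for all $x\in(0,\pi/2)$ if and only if $p_1\ge 3q-\frac85$. -/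

import Mathlib

open Filter Topology

namespace SincBounds

noncomputable section

/-- `S_p(x) = (1 - (sin x / x)^p) / p`, read as its limit `-ln (sin x / x)` for `p = 0`. -/
def S (p x : ℝ) : ℝ :=
  if p = 0 then -Real.log (Real.sin x / x) else (1 - (Real.sin x / x) ^ p) / p

/-- `C_q(x) = (1 - cos^q x) / q`, read as its limit `-ln (cos x)` for `q = 0`. -/
def C (q x : ℝ) : ℝ :=
  if q = 0 then -Real.log (Real.cos x) else (1 - Real.cos x ^ q) / q

/-- `D_{p,q}(x) = S_p(x) / C_q(x) - 1/3`. -/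
def D (p q x : ℝ) : ℝ := S p x / C q x - 1 / 3

/-- `p` is a root of the equation `D_{p,q}(π/2⁻) = 0`, where `D_{p,q}(π/2⁻)` is the limit of
`D_{p,q}(x)` as `x` tends to `π/2` from the left. -/
def IsRoot (p q : ℝ) : Prop := Tendsto (D p q) (𝓝[<] (Real.pi / 2)) (𝓝 0)

/-- `p(q)`: the root `p` of the equation `D_{p,q}(π/2⁻) = 0` (of interest for `q > 0`). -/
def pOf (q : ℝ) : ℝ := Classical.epsilon fun p : ℝ => IsRoot p q

/-- `q(p) = p / (3 (1 - (2/π)^p))` for `p ≠ 0` and `q(0) = -1 / (3 ln (2/π))`. -/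
def qOf (p : ℝ) : ℝ :=
  if p = 0 then -1 / (3 * Real.log (2 / Real.pi)) else p / (3 * (1 - (2 / Real.pi) ^ p))

/-- The region `E = {(p, q) : p ≤ 0 or 0 < p ≤ 3q}`. -/
def E : Set (ℝ × ℝ) := {z | z.1 ≤ 0 ∨ (0 < z.1 ∧ z.1 ≤ 3 * z.2)}

/-- `M(t; p, q) = (1 - p/(3q) + (p/(3q)) t^q)^(1/p)`, read as its limit where `pq = 0`. -/
def M (t p q : ℝ) : ℝ :=
  if q = 0 then
    if p = 0 then t ^ ((1 : ℝ) / 3) else (p / 3 * Real.log t + 1) ^ (1 / p)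
  else
    if p = 0 then Real.exp ((t ^ q - 1) / (3 * q))
    else (1 - p / (3 * q) + p / (3 * q) * t ^ q) ^ (1 / p)

end

end SincBounds

/-! Put u = -ln(sin x/x), v = -ln cos x and φ_p(u) = ∫₀ᵘ e^(-pt) dt. Then S_p = φ_p(u), C_q =
φ_q(v), and M solves 3φ_p(-ln M) = φ_q(v). As φ_p is increasing, each half of (*) is a sign
condition on `gap` = 3φ_p(u) - φ_q(v).

`gap` vanishes at 0⁺ and its derivative has the sign of `logSlope` = ln(3S_p'/C_q'). That too
vanishes at 0⁺, and its derivative has the sign of `secondRatio` = (1-p) + (q-1)A + B, where A =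
v'/u' and B is free of p and q. This is a double monotone l'Hôpital rule (`SignChain`).

The analytic core is that B and A - 35B are strictly increasing, so `secondRatio` is strictly
increasing for q ≥ 1 and strictly decreasing for q ≤ 34/35. Its limit at 0⁺ is 3q - 8/5 - p, which
yields one sharp constant. The other comes from the limit of `gap` at π/2, whose sign compares p
with p(q) because φ_p(ln(π/2)) is strictly decreasing in p. -/

namespace SincBounds

/-! ### Alternating Taylor bounds for sine and cosine -/

/-- Taylor polynomial of `cos` with `n` terms. -/
noncomputable def cosTaylor (n : ℕ) (x : ℝ) : ℝ :=
  ∑ j ∈ Finset.range n, (-1) ^ j * x ^ (2 * j) / (2 * j).factorial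

/-- Taylor polynomial of `sin` with `n` terms. -/
noncomputable def sinTaylor (n : ℕ) (x : ℝ) : ℝ :=
  ∑ j ∈ Finset.range n, (-1) ^ j * x ^ (2 * j + 1) / (2 * j + 1).factorial

theorem hasDerivAt_sinTaylor (n : ℕ) (x : ℝ) :
    HasDerivAt (sinTaylor n) (cosTaylor n x) x := by
  unfold sinTaylor cosTaylor
  refine HasDerivAt.fun_sum fun j _ => ?_
  have := (((hasDerivAt_id x).pow (2 * j + 1)).const_mul ((-1 : ℝ) ^ j)).div_const
    ((2 * j + 1).factorial : ℝ)
  refine this.congr_deriv ?_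
  rw [Nat.factorial_succ]
  have : ((2 * j).factorial : ℝ) ≠ 0 := by positivity
  push_cast
  simp only [id]
  field_simp

theorem hasDerivAt_cosTaylor (n : ℕ) (x : ℝ) :
    HasDerivAt (cosTaylor (n + 1)) (-sinTaylor n x) x := by
  have e : cosTaylor (n + 1) = fun x => (∑ j ∈ Finset.range n,
      (-1 : ℝ) ^ (j + 1) * x ^ (2 * j + 1 + 1) / (2 * j + 1 + 1).factorial) + 1 := by
    funext y
    simp [cosTaylor, Finset.sum_range_succ', mul_add]
  rw [e, sinTaylor, ← Finset.sum_neg_distrib]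
  refine HasDerivAt.add_const _ (HasDerivAt.fun_sum fun j _ => ?_)
  have := (((hasDerivAt_id x).pow (2 * j + 1 + 1)).const_mul ((-1 : ℝ) ^ (j + 1))).div_const
    ((2 * j + 1 + 1).factorial : ℝ)
  refine this.congr_deriv ?_
  rw [Nat.factorial_succ (2 * j + 1)]
  have : ((2 * j + 1).factorial : ℝ) ≠ 0 := by positivity
  push_cast
  simp only [id]
  field_simp
  ring

theorem nonneg_of_hasDerivAt_nonneg {f f' : ℝ → ℝ} (hf : ∀ x, HasDerivAt f (f' x) x)
    (hf' : ∀ x, 0 ≤ x → 0 ≤ f' x) (h0 : 0 ≤ f 0) {x : ℝ} (hx : 0 ≤ x) : 0 ≤ f x := by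
  have hm : MonotoneOn f (Set.Ici 0) := by
    refine monotoneOn_of_deriv_nonneg (convex_Ici 0)
      (fun y _ => (hf y).continuousAt.continuousWithinAt)
      (fun y _ => (hf y).differentiableAt.differentiableWithinAt) fun y hy => ?_
    rw [interior_Ici] at hy
    rw [(hf y).deriv]
    exact hf' y (le_of_lt hy)
  exact h0.trans (hm Set.self_mem_Ici hx hx)

/-- Integrating from 0 carries the sign of the cosine remainder to the sine remainder, and then,
reversed, to the next cosine remainder; the chain starts from cos ≤ 1. -/
theorem taylor_sign (n : ℕ) {x : ℝ} (hx : 0 ≤ x) :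
    0 ≤ (-1) ^ (n + 1) * (Real.cos x - cosTaylor (n + 1) x) ∧
      0 ≤ (-1) ^ (n + 1) * (Real.sin x - sinTaylor (n + 1) x) := by
  have step : ∀ n, (∀ x : ℝ, 0 ≤ x → 0 ≤ (-1) ^ (n + 1) * (Real.cos x - cosTaylor (n + 1) x)) →
      ∀ x : ℝ, 0 ≤ x → 0 ≤ (-1) ^ (n + 1) * (Real.sin x - sinTaylor (n + 1) x) := by
    intro n h x hx
    refine nonneg_of_hasDerivAt_nonneg (f := fun x => (-1) ^ (n + 1) *
      (Real.sin x - sinTaylor (n + 1) x)) (fun y =>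
      ((Real.hasDerivAt_sin y).sub (hasDerivAt_sinTaylor (n + 1) y)).const_mul _) h ?_ hx
    simp [sinTaylor]
  have main : ∀ x : ℝ, 0 ≤ x → 0 ≤ (-1) ^ (n + 1) * (Real.cos x - cosTaylor (n + 1) x) := by
    induction n with
    | zero =>
      intro x hx
      simpa [cosTaylor] using Real.cos_le_one x
    | succ n ih =>
      intro x hx
      refine nonneg_of_hasDerivAt_nonneg (f := fun x => (-1) ^ (n + 1 + 1) *
        (Real.cos x - cosTaylor (n + 1 + 1) x)) (fun y =>
        ((Real.hasDerivAt_cos y).sub (hasDerivAt_cosTaylor (n + 1) y)).const_mul _)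
        (fun y hy => ?_) ?_ hx
      · have := step n ih y hy
        rw [pow_succ]
        linarith
      · simp [cosTaylor, Finset.sum_range_succ']
  exact ⟨main x hx, step n main x hx⟩

theorem cos_le_cosTaylor {n : ℕ} (hn : Odd n) {x : ℝ} (hx : 0 ≤ x) :
    Real.cos x ≤ cosTaylor n x := by
  obtain ⟨m, rfl⟩ := hn
  have := (taylor_sign (2 * m) hx).1
  rw [Odd.neg_one_pow ⟨m, rfl⟩] at this
  linarith

theorem sin_le_sinTaylor {n : ℕ} (hn : Odd n) {x : ℝ} (hx : 0 ≤ x) :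
    Real.sin x ≤ sinTaylor n x := by
  obtain ⟨m, rfl⟩ := hn
  have := (taylor_sign (2 * m) hx).2
  rw [Odd.neg_one_pow ⟨m, rfl⟩] at this
  linarith

theorem cosTaylor_le_cos {n : ℕ} (hn : Odd n) {x : ℝ} (hx : 0 ≤ x) :
    cosTaylor (n + 1) x ≤ Real.cos x := by
  have := (taylor_sign n hx).1
  rw [hn.add_one.neg_one_pow] at this
  linarith

theorem sinTaylor_le_sin {n : ℕ} (hn : Odd n) {x : ℝ} (hx : 0 ≤ x) :
    sinTaylor (n + 1) x ≤ Real.sin x := by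
  have := (taylor_sign n hx).2
  rw [hn.add_one.neg_one_pow] at this
  linarith

/-! ### Two trigonometric inequalities, reduced to polynomials -/

theorem sin_five_mul (x : ℝ) :
    Real.sin (5 * x) = 16 * Real.sin x ^ 5 - 20 * Real.sin x ^ 3 + 5 * Real.sin x := by
  have h := Real.sin_sq_add_cos_sq x
  rw [show 5 * x = 3 * x + 2 * x by ring, Real.sin_add, Real.sin_three_mul, Real.cos_three_mul,
    Real.sin_two_mul, Real.cos_two_mul']
  linear_combination (-Real.sin x * (4 * Real.sin x ^ 2 - 3) +
    8 * Real.sin x * (Real.cos x ^ 2 + 1 - Real.sin x ^ 2) - 6 * Real.sin x) * h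

theorem cos_five_mul (x : ℝ) :
    Real.cos (5 * x) = 16 * Real.cos x ^ 5 - 20 * Real.cos x ^ 3 + 5 * Real.cos x := by
  have h := Real.sin_sq_add_cos_sq x
  rw [show 5 * x = 3 * x + 2 * x by ring, Real.cos_add, Real.sin_three_mul, Real.cos_three_mul,
    Real.sin_two_mul, Real.cos_two_mul]
  linear_combination (-6 * Real.cos x + 8 * Real.cos x * (Real.sin x ^ 2 + 1 - Real.cos x ^ 2)) * h

theorem sq_le_of_le_pi_div_two {x : ℝ} (hx : 0 < x) (hx' : x ≤ Real.pi / 2) :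
    x ^ 2 ≤ 2.468 := by
  have := Real.pi_lt_d4
  nlinarith

/-- This is the numerator of B'. Multiple angles make it linear in sines and cosines with
coefficients polynomial in x, so one-sided Taylor bounds apply term by term. -/
theorem trig_pos_aux₁ {x : ℝ} (hx : 0 < x) (hx' : x ≤ Real.pi / 2) :
    0 < 6 * x * Real.sin x - x * Real.sin x ^ 3 - 3 * x ^ 2 * Real.cos x
      - 3 * Real.sin x ^ 2 * Real.cos x - 2 * x ^ 3 * Real.sin x := by
  have hy := sq_le_of_le_pi_div_two hx hx'
  have h := Real.sin_sq_add_cos_sq x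
  have e : 6 * x * Real.sin x - x * Real.sin x ^ 3 - 3 * x ^ 2 * Real.cos x
      - 3 * Real.sin x ^ 2 * Real.cos x - 2 * x ^ 3 * Real.sin x =
      21 / 4 * x * Real.sin x + 1 / 4 * x * Real.sin (3 * x) - 3 * x ^ 2 * Real.cos x
      + 3 / 4 * Real.cos (3 * x) - 3 / 4 * Real.cos x - 2 * x ^ 3 * Real.sin x := by
    rw [Real.sin_three_mul, Real.cos_three_mul]
    linear_combination (-3 * Real.cos x) * h
  have b1 := mul_le_mul_of_nonneg_left (sinTaylor_le_sin (n := 7) (by decide) hx.le)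
    (by positivity : 0 ≤ 21 / 4 * x)
  have b2 := mul_le_mul_of_nonneg_left
    (sinTaylor_le_sin (n := 7) (x := 3 * x) (by decide) (by positivity))
    (by positivity : 0 ≤ 1 / 4 * x)
  have b3 := mul_le_mul_of_nonneg_left (cos_le_cosTaylor (n := 7) (by decide) hx.le)
    (by positivity : 0 ≤ 3 * x ^ 2)
  have b4 := cosTaylor_le_cos (n := 7) (x := 3 * x) (by decide) (by positivity)
  have b5 := cos_le_cosTaylor (n := 9) (by decide) hx.le
  have b6 := mul_le_mul_of_nonneg_left (sin_le_sinTaylor (n := 7) (by decide) hx.le)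
    (by positivity : 0 ≤ 2 * x ^ 3)
  simp only [cosTaylor, sinTaylor, Finset.sum_range_succ, Finset.sum_range_zero, Nat.factorial]
    at b1 b2 b3 b4 b5 b6
  -- The Taylor bounds combine to this polynomial: all terms below order 10 cancel.
  have key : 0 < x ^ 10 * (8 / 4725 - 4 / 14175 * x ^ 2 + x ^ 4 * (1 / 43659
      - 5887429 / 2145927168000 * x ^ 2)) := by
    have : 0 ≤ x ^ 4 * (1 / 43659 - 5887429 / 2145927168000 * x ^ 2) :=
      mul_nonneg (by positivity) (by linarith)
    exact mul_pos (by positivity) (by linarith)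
  rw [e]
  refine key.trans_le ?_
  norm_num at b1 b2 b3 b4 b5 b6
  ring_nf at b1 b2 b3 b4 b5 b6 ⊢
  linarith

theorem poly_pos_aux {y : ℝ} (h0 : 0 ≤ y) (hy : y ≤ 2.468) :
    0 < 64 / 1575 - 416 / 17325 * y + 46168 / 7882875 * y ^ 2
      - 179876 / 212837625 * y ^ 3 + y ^ 4 * (3031129 / 36182396250
      - 131040617 / 21173938285500 * y
      - 310319840601492721 / 496358721386591551488000 * y ^ 2) := by
  have hy2 : y ^ 2 ≤ 2.468 * y := by nlinarith
  have hy3 : y ^ 3 ≤ 2.468 * y ^ 2 := by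
    rw [pow_succ' y 2]
    exact mul_le_mul_of_nonneg_right hy (sq_nonneg y)
  have h9 : 0 ≤ y ^ 4 * (3031129 / 36182396250 - 131040617 / 21173938285500 * y
      - 310319840601492721 / 496358721386591551488000 * y ^ 2) :=
    mul_nonneg (by positivity) (by linarith)
  -- Bounding y³ by 2.468y² leaves a quadratic whose vertex is near 3.18.
  linarith [sq_nonneg (y - 3.18)]

/-- This is the numerator of (A - 35B)' over the denominator cos² x (sin x - x cos x)³. The constant
35 cancels the order 10 term, so the expansion starts at x¹². -/
theorem trig_pos_aux₂ {x : ℝ} (hx : 0 < x) (hx' : x ≤ Real.pi / 2) :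
    0 < Real.sin x ^ 4 * Real.cos x + x * Real.sin x ^ 5 - 3 * x ^ 2 * Real.sin x ^ 2 * Real.cos x
      + 72 * x ^ 3 * Real.sin x * Real.cos x ^ 2 - 210 * x * Real.sin x * Real.cos x ^ 2
      + 35 * x * Real.sin x ^ 3 * Real.cos x ^ 2 + 105 * x ^ 2 * Real.cos x ^ 3
      + 105 * Real.sin x ^ 2 * Real.cos x ^ 3 := by
  have hy := sq_le_of_le_pi_div_two hx hx'
  have h := Real.sin_sq_add_cos_sq x
  have e : Real.sin x ^ 4 * Real.cos x + x * Real.sin x ^ 5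
      - 3 * x ^ 2 * Real.sin x ^ 2 * Real.cos x
      + 72 * x ^ 3 * Real.sin x * Real.cos x ^ 2 - 210 * x * Real.sin x * Real.cos x ^ 2
      + 35 * x * Real.sin x ^ 3 * Real.cos x ^ 2 + 105 * x ^ 2 * Real.cos x ^ 3
      + 105 * Real.sin x ^ 2 * Real.cos x ^ 3 =
      -(13 / 2) * Real.cos (5 * x) - 27 / 4 * Real.cos (3 * x) + 53 / 4 * Real.cos x
      - 17 / 8 * x * Real.sin (5 * x) - 405 / 8 * x * Real.sin (3 * x) - 95 / 2 * x * Real.sin x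
      + 27 * x ^ 2 * Real.cos (3 * x) + 78 * x ^ 2 * Real.cos x
      + 18 * x ^ 3 * Real.sin (3 * x) + 18 * x ^ 3 * Real.sin x := by
    have e1 : Real.sin x ^ 2 * Real.cos x = (1 - Real.cos x ^ 2) * Real.cos x := by
      rw [← h]; ring
    have e2 : Real.sin x * Real.cos x ^ 2 = (1 - Real.sin x ^ 2) * Real.sin x := by
      rw [← h]; ring
    have e3 : Real.sin x ^ 4 * Real.cos x = (1 - Real.cos x ^ 2) ^ 2 * Real.cos x := by
      rw [← h]; ring
    rw [Real.sin_three_mul, Real.cos_three_mul, sin_five_mul, cos_five_mul]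
    linear_combination e3 + (-3 * x ^ 2 + 105 * Real.cos x ^ 2) * e1 +
      (72 * x ^ 3 - 210 * x + 35 * x * Real.sin x ^ 2) * e2
  have c5 := cos_le_cosTaylor (n := 13) (x := 5 * x) (by decide) (by positivity)
  have c3 := cos_le_cosTaylor (n := 13) (x := 3 * x) (by decide) (by positivity)
  have c1 := cosTaylor_le_cos (n := 11) (by decide) hx.le
  have s5 := mul_le_mul_of_nonneg_left
    (sin_le_sinTaylor (n := 11) (x := 5 * x) (by decide) (by positivity))
    (by positivity : 0 ≤ 17 / 8 * x)
  have s3 := mul_le_mul_of_nonneg_left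
    (sin_le_sinTaylor (n := 11) (x := 3 * x) (by decide) (by positivity))
    (by positivity : 0 ≤ 405 / 8 * x)
  have s1 := mul_le_mul_of_nonneg_left (sin_le_sinTaylor (n := 11) (by decide) hx.le)
    (by positivity : 0 ≤ 95 / 2 * x)
  have d3 := mul_le_mul_of_nonneg_left
    (cosTaylor_le_cos (n := 11) (x := 3 * x) (by decide) (by positivity))
    (by positivity : 0 ≤ 27 * x ^ 2)
  have d1 := mul_le_mul_of_nonneg_left (cosTaylor_le_cos (n := 11) (by decide) hx.le)
    (by positivity : 0 ≤ 78 * x ^ 2)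
  have t3 := mul_le_mul_of_nonneg_left
    (sinTaylor_le_sin (n := 9) (x := 3 * x) (by decide) (by positivity))
    (by positivity : 0 ≤ 18 * x ^ 3)
  have t1 := mul_le_mul_of_nonneg_left (sinTaylor_le_sin (n := 9) (by decide) hx.le)
    (by positivity : 0 ≤ 18 * x ^ 3)
  simp only [cosTaylor, sinTaylor, Finset.sum_range_succ, Finset.sum_range_zero, Nat.factorial]
    at c5 c3 c1 s5 s3 s1 d3 d1 t3 t1
  have key : 0 < x ^ 12 * (64 / 1575 - 416 / 17325 * x ^ 2 + 46168 / 7882875 * (x ^ 2) ^ 2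
      - 179876 / 212837625 * (x ^ 2) ^ 3 + (x ^ 2) ^ 4 * (3031129 / 36182396250
      - 131040617 / 21173938285500 * x ^ 2
      - 310319840601492721 / 496358721386591551488000 * (x ^ 2) ^ 2)) := by
    refine mul_pos (by positivity) ?_
    have := poly_pos_aux (sq_nonneg x) hy
    linarith
  rw [e]
  refine key.trans_le ?_
  norm_num at c5 c3 c1 s5 s3 s1 d3 d1 t3 t1
  ring_nf at c5 c3 c1 s5 s3 s1 d3 d1 t3 t1 ⊢
  linarith

/-! ### Monotonicity of the ratios A and B -/

/-- The numerator `sin x - x cos x` of the logarithmic derivative of `x / sin x`. -/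
noncomputable def sinSubMulCos (x : ℝ) : ℝ := Real.sin x - x * Real.cos x

/-- The quotient of the logarithmic derivatives of `cos x` and `sin x / x`. -/
noncomputable def ratioA (x : ℝ) : ℝ :=
  x * Real.sin x ^ 2 / (Real.cos x * sinSubMulCos x)

/-- The part of the second-order quotient that does not depend on the exponents. -/
noncomputable def ratioB (x : ℝ) : ℝ :=
  (x ^ 2 - 2 * Real.sin x ^ 2 + x * Real.sin x * Real.cos x) / sinSubMulCos x ^ 2

theorem hasDerivAt_sinSubMulCos (x : ℝ) :
    HasDerivAt sinSubMulCos (x * Real.sin x) x := by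
  refine ((Real.hasDerivAt_sin x).sub ((hasDerivAt_id x).mul
    (Real.hasDerivAt_cos x))).congr_deriv ?_
  simp

theorem sin_pos_of_mem {x : ℝ} (hx : x ∈ Set.Ioo 0 (Real.pi / 2)) : 0 < Real.sin x :=
  Real.sin_pos_of_pos_of_lt_pi hx.1 (by linarith [hx.2, Real.pi_pos])

theorem cos_pos_of_mem {x : ℝ} (hx : x ∈ Set.Ioo 0 (Real.pi / 2)) : 0 < Real.cos x :=
  Real.cos_pos_of_mem_Ioo ⟨by linarith [hx.1, Real.pi_pos], hx.2⟩

theorem sinSubMulCos_pos {x : ℝ} (hx : x ∈ Set.Ioo 0 (Real.pi / 2)) : 0 < sinSubMulCos x := by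
  have h1 := Real.lt_tan hx.1 hx.2
  rw [Real.tan_eq_sin_div_cos, lt_div_iff₀ (cos_pos_of_mem hx)] at h1
  unfold sinSubMulCos
  linarith

theorem hasDerivAt_ratioA {x : ℝ} (hx : x ∈ Set.Ioo 0 (Real.pi / 2)) :
    HasDerivAt ratioA (Real.sin x * (Real.sin x ^ 2 * Real.cos x + x * Real.sin x
      - 2 * x ^ 2 * Real.cos x) / (Real.cos x ^ 2 * sinSubMulCos x ^ 2)) x := by
  have hc := cos_pos_of_mem hx
  have hw := sinSubMulCos_pos hx
  have hd := ((hasDerivAt_id x).mul ((Real.hasDerivAt_sin x).pow 2)).div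
    ((Real.hasDerivAt_cos x).mul (hasDerivAt_sinSubMulCos x)) (mul_pos hc hw).ne'
  refine hd.congr_deriv ?_
  simp only [Pi.mul_apply, Pi.pow_apply, id]
  field_simp
  have h := Real.sin_sq_add_cos_sq x
  unfold sinSubMulCos
  push_cast
  linear_combination (x * Real.sin x ^ 2 - 2 * x ^ 2 * Real.sin x * Real.cos x) * h

theorem hasDerivAt_ratioB {x : ℝ} (hx : x ∈ Set.Ioo 0 (Real.pi / 2)) :
    HasDerivAt ratioB ((6 * x * Real.sin x - x * Real.sin x ^ 3 - 3 * x ^ 2 * Real.cos x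
      - 3 * Real.sin x ^ 2 * Real.cos x - 2 * x ^ 3 * Real.sin x) / sinSubMulCos x ^ 3) x := by
  have hw := sinSubMulCos_pos hx
  have hd := ((((hasDerivAt_id x).pow 2).sub (((Real.hasDerivAt_sin x).pow 2).const_mul 2)).add
    (((hasDerivAt_id x).mul (Real.hasDerivAt_sin x)).mul (Real.hasDerivAt_cos x))).div
    ((hasDerivAt_sinSubMulCos x).pow 2) (pow_pos hw 2).ne'
  refine (hd.congr_of_eventuallyEq (Eventually.of_forall fun y => ?_)).congr_deriv ?_
  · simp [ratioB]
  simp only [Pi.mul_apply, Pi.pow_apply, Pi.add_apply, Pi.sub_apply, id]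
  field_simp
  have h := Real.sin_sq_add_cos_sq x
  unfold sinSubMulCos
  push_cast
  have h2 : Real.cos x ^ 2 = 1 - Real.sin x ^ 2 := by linarith
  ring_nf
  simp only [h2, show Real.cos x ^ 3 = Real.cos x * (1 - Real.sin x ^ 2) by rw [← h2]; ring,
    show Real.cos x ^ 4 = (1 - Real.sin x ^ 2) ^ 2 by rw [← h2]; ring]
  ring

theorem strictMonoOn_of_hasDerivAt_pos {f f' : ℝ → ℝ} {a b : ℝ}
    (hf : ∀ x ∈ Set.Ioo a b, HasDerivAt f (f' x) x) (hf' : ∀ x ∈ Set.Ioo a b, 0 < f' x) :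
    StrictMonoOn f (Set.Ioo a b) := by
  refine strictMonoOn_of_deriv_pos (convex_Ioo a b)
    (fun y hy => (hf y hy).continuousAt.continuousWithinAt) fun y hy => ?_
  rw [interior_Ioo] at hy
  rw [(hf y hy).deriv]
  exact hf' y hy

theorem strictMonoOn_ratioB : StrictMonoOn ratioB (Set.Ioo 0 (Real.pi / 2)) :=
  strictMonoOn_of_hasDerivAt_pos (fun _ hx => hasDerivAt_ratioB hx) fun _ hx =>
    div_pos (trig_pos_aux₁ hx.1 hx.2.le) (pow_pos (sinSubMulCos_pos hx) 3)

/-- Near 0, A' ~ 8x/5 and B' ~ 8x/175, so 35 is the largest constant possible here; it is the source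
of 34/35 = 1 - 1/35. -/
theorem strictMonoOn_ratioA_sub_ratioB :
    StrictMonoOn (fun x => ratioA x - 35 * ratioB x) (Set.Ioo 0 (Real.pi / 2)) := by
  refine strictMonoOn_of_hasDerivAt_pos
    (fun _ hx => (hasDerivAt_ratioA hx).sub ((hasDerivAt_ratioB hx).const_mul 35)) fun x hx => ?_
  have hc := cos_pos_of_mem hx
  have hw := sinSubMulCos_pos hx
  have key := trig_pos_aux₂ hx.1 hx.2.le
  have h := Real.sin_sq_add_cos_sq x
  set P := 6 * x * Real.sin x - x * Real.sin x ^ 3 - 3 * x ^ 2 * Real.cos x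
      - 3 * Real.sin x ^ 2 * Real.cos x - 2 * x ^ 3 * Real.sin x with hP
  have e : Real.sin x * (Real.sin x ^ 2 * Real.cos x + x * Real.sin x
      - 2 * x ^ 2 * Real.cos x) / (Real.cos x ^ 2 * sinSubMulCos x ^ 2)
      - 35 * (P / sinSubMulCos x ^ 3) = (Real.sin x * (Real.sin x ^ 2 * Real.cos x + x * Real.sin x
      - 2 * x ^ 2 * Real.cos x) * sinSubMulCos x - 35 * Real.cos x ^ 2 * P) /
      (Real.cos x ^ 2 * sinSubMulCos x ^ 3) := by
    field_simp
  rw [e]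
  refine div_pos (key.trans_eq ?_) (by positivity)
  rw [hP, sinSubMulCos]
  linear_combination x * Real.sin x ^ 3 * h

theorem monotoneOn_ratioA : MonotoneOn ratioA (Set.Ioo 0 (Real.pi / 2)) := by
  intro x hx y hy hxy
  have h1 := strictMonoOn_ratioB.monotoneOn hx hy hxy
  have h2 := strictMonoOn_ratioA_sub_ratioB.monotoneOn hx hy hxy
  linarith

/-! ### Limits of A and B at 0⁺ -/

theorem sinSubMulCos_bounds {x : ℝ} (hx : 0 ≤ x) :
    x ^ 3 * (1 / 3 - x ^ 2 / 6) ≤ sinSubMulCos x ∧ sinSubMulCos x ≤ x ^ 3 * (1 / 3 + x ^ 2 / 6) := by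
  have s1 := sinTaylor_le_sin (n := 1) (by decide) hx
  have s2 := sin_le_sinTaylor (n := 3) (by decide) hx
  have c1 := mul_le_mul_of_nonneg_left (cosTaylor_le_cos (n := 1) (by decide) hx) hx
  have c2 := mul_le_mul_of_nonneg_left (cos_le_cosTaylor (n := 3) (by decide) hx) hx
  simp only [cosTaylor, sinTaylor, Finset.sum_range_succ, Finset.sum_range_zero, Nat.factorial]
    at s1 s2 c1 c2
  norm_num at s1 s2 c1 c2
  ring_nf at s1 s2 c1 c2
  unfold sinSubMulCos
  have := pow_nonneg hx 5
  constructor <;> ring_nf <;> linarith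

theorem ratioB_num_bounds {x : ℝ} (hx : 0 ≤ x) :
    x ^ 6 * (2 / 45 - x ^ 2) ≤ x ^ 2 - 2 * Real.sin x ^ 2 + x * Real.sin x * Real.cos x ∧
      x ^ 2 - 2 * Real.sin x ^ 2 + x * Real.sin x * Real.cos x ≤ x ^ 6 * (2 / 45 + x ^ 2) := by
  have e : x ^ 2 - 2 * Real.sin x ^ 2 + x * Real.sin x * Real.cos x =
      x ^ 2 - 1 + Real.cos (2 * x) + 1 / 2 * x * Real.sin (2 * x) := by
    rw [Real.sin_two_mul, Real.cos_two_mul']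
    linear_combination -Real.sin_sq_add_cos_sq x
  have h2 : 0 ≤ 2 * x := by positivity
  have h3 : 0 ≤ 1 / 2 * x := by positivity
  have c1 := cosTaylor_le_cos (n := 3) (by decide) h2
  have c2 := cos_le_cosTaylor (n := 5) (by decide) h2
  have s1 := mul_le_mul_of_nonneg_left (sinTaylor_le_sin (n := 3) (by decide) h2) h3
  have s2 := mul_le_mul_of_nonneg_left (sin_le_sinTaylor (n := 3) (by decide) h2) h3
  simp only [cosTaylor, sinTaylor, Finset.sum_range_succ, Finset.sum_range_zero, Nat.factorial]
    at s1 s2 c1 c2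
  norm_num at s1 s2 c1 c2
  ring_nf at s1 s2 c1 c2
  rw [e]
  have := pow_nonneg hx 8
  constructor <;> ring_nf <;> linarith

theorem tendsto_sinSubMulCos_div :
    Tendsto (fun x => sinSubMulCos x / x ^ 3) (𝓝[>] 0) (𝓝 (1 / 3)) := by
  have t1 : Tendsto (fun x : ℝ => 1 / 3 - x ^ 2 / 6) (𝓝[>] 0) (𝓝 (1 / 3)) :=
    tendsto_nhdsWithin_of_tendsto_nhds (Continuous.tendsto' (by fun_prop) _ _ (by simp))
  have t2 : Tendsto (fun x : ℝ => 1 / 3 + x ^ 2 / 6) (𝓝[>] 0) (𝓝 (1 / 3)) :=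
    tendsto_nhdsWithin_of_tendsto_nhds (Continuous.tendsto' (by fun_prop) _ _ (by simp))
  refine tendsto_of_tendsto_of_tendsto_of_le_of_le' t1 t2 ?_ ?_ <;>
    filter_upwards [self_mem_nhdsWithin] with x (hx : 0 < x)
  · rw [le_div_iff₀' (by positivity)]
    exact (sinSubMulCos_bounds hx.le).1
  · rw [div_le_iff₀' (by positivity)]
    exact (sinSubMulCos_bounds hx.le).2

theorem tendsto_ratioB : Tendsto ratioB (𝓝[>] 0) (𝓝 (2 / 5)) := by
  have t1 : Tendsto (fun x : ℝ => 2 / 45 - x ^ 2) (𝓝[>] 0) (𝓝 (2 / 45)) :=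
    tendsto_nhdsWithin_of_tendsto_nhds (Continuous.tendsto' (by fun_prop) _ _ (by simp))
  have t2 : Tendsto (fun x : ℝ => 2 / 45 + x ^ 2) (𝓝[>] 0) (𝓝 (2 / 45)) :=
    tendsto_nhdsWithin_of_tendsto_nhds (Continuous.tendsto' (by fun_prop) _ _ (by simp))
  have t3 : Tendsto (fun x => (x ^ 2 - 2 * Real.sin x ^ 2 + x * Real.sin x * Real.cos x) / x ^ 6)
      (𝓝[>] 0) (𝓝 (2 / 45)) := by
    refine tendsto_of_tendsto_of_tendsto_of_le_of_le' t1 t2 ?_ ?_ <;>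
      filter_upwards [self_mem_nhdsWithin] with x (hx : 0 < x)
    · rw [le_div_iff₀' (by positivity)]
      exact (ratioB_num_bounds hx.le).1
    · rw [div_le_iff₀' (by positivity)]
      exact (ratioB_num_bounds hx.le).2
  have t4 := t3.div (tendsto_sinSubMulCos_div.pow 2) (by norm_num)
  norm_num at t4
  refine t4.congr' ?_
  filter_upwards [self_mem_nhdsWithin] with x (hx : 0 < x)
  simp only [Pi.div_apply, ratioB]
  field_simp

theorem tendsto_sin_div : Tendsto (fun x => Real.sin x / x) (𝓝[>] 0) (𝓝 1) := by
  have : Tendsto Real.sinc (𝓝[>] 0) (𝓝 1) :=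
    tendsto_nhdsWithin_of_tendsto_nhds (Real.continuous_sinc.tendsto' _ _ Real.sinc_zero)
  refine this.congr' ?_
  filter_upwards [self_mem_nhdsWithin] with x (hx : 0 < x)
  exact Real.sinc_of_ne_zero hx.ne'

theorem tendsto_cos_zero : Tendsto Real.cos (𝓝[>] 0) (𝓝 1) :=
  tendsto_nhdsWithin_of_tendsto_nhds (Real.continuous_cos.tendsto' _ _ Real.cos_zero)

theorem tendsto_ratioA : Tendsto ratioA (𝓝[>] 0) (𝓝 3) := by
  have t := (tendsto_sin_div.pow 2).div (tendsto_cos_zero.mul tendsto_sinSubMulCos_div)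
    (by norm_num)
  norm_num at t
  refine t.congr' ?_
  filter_upwards [self_mem_nhdsWithin] with x (hx : 0 < x)
  simp only [Pi.div_apply, ratioA]
  field_simp

/-! ### Propagating signs through two derivatives -/

theorem exists_deriv_nonneg {g g' : ℝ → ℝ} {b x₀ : ℝ}
    (hg : ∀ x ∈ Set.Ioo 0 b, HasDerivAt g (g' x) x) (h0 : Tendsto g (𝓝[>] 0) (𝓝 0))
    (hx₀ : x₀ ∈ Set.Ioo 0 b) (h : 0 ≤ g x₀) : ∃ ξ ∈ Set.Ioo 0 x₀, 0 ≤ g' ξ := by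
  by_contra! hneg
  have hanti : StrictAntiOn g (Set.Ioc 0 x₀) := by
    refine strictAntiOn_of_deriv_neg (convex_Ioc 0 x₀) (fun y hy =>
      (hg y ⟨hy.1, hy.2.trans_lt hx₀.2⟩).continuousAt.continuousWithinAt) fun y hy => ?_
    rw [interior_Ioc] at hy
    rw [(hg y ⟨hy.1, hy.2.trans hx₀.2⟩).deriv]
    exact hneg y hy
  -- The limit at 0⁺ gives only g ≤ 0; an intermediate point restores strictness at x₀.
  have hm : x₀ / 2 ∈ Set.Ioc 0 x₀ := ⟨half_pos hx₀.1, half_le_self hx₀.1.le⟩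
  have h1 : g x₀ < g (x₀ / 2) := hanti hm ⟨hx₀.1, le_rfl⟩ (half_lt_self hx₀.1)
  have h2 : g (x₀ / 2) ≤ 0 := by
    refine ge_of_tendsto h0 ?_
    filter_upwards [Ioo_mem_nhdsGT (half_pos hx₀.1)] with y hy
    exact hanti.antitoneOn ⟨hy.1, hy.2.le.trans hm.2⟩ hm hy.2.le
  linarith

/-- Functions `h`, `k` on `(0, b)` that vanish at `0⁺`, such that `h'` has the sign of `k` and
`k'` has the sign of `H`. -/
structure SignChain (b : ℝ) (h h' k k' H : ℝ → ℝ) : Prop where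
  hasDerivAt_left : ∀ x ∈ Set.Ioo 0 b, HasDerivAt h (h' x) x
  hasDerivAt_right : ∀ x ∈ Set.Ioo 0 b, HasDerivAt k (k' x) x
  tendsto_left : Tendsto h (𝓝[>] 0) (𝓝 0)
  tendsto_right : Tendsto k (𝓝[>] 0) (𝓝 0)
  nonneg_left : ∀ x ∈ Set.Ioo 0 b, (0 ≤ h' x ↔ 0 ≤ k x)
  nonpos_left : ∀ x ∈ Set.Ioo 0 b, (h' x ≤ 0 ↔ k x ≤ 0)
  nonneg_right : ∀ x ∈ Set.Ioo 0 b, (0 ≤ k' x ↔ 0 ≤ H x)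
  nonpos_right : ∀ x ∈ Set.Ioo 0 b, (k' x ≤ 0 ↔ H x ≤ 0)

namespace SignChain

variable {b : ℝ} {h h' k k' H : ℝ → ℝ}

theorem neg (c : SignChain b h h' k k' H) :
    SignChain b (fun x => -h x) (fun x => -h' x) (fun x => -k x) (fun x => -k' x)
      (fun x => -H x) where
  hasDerivAt_left x hx := (c.hasDerivAt_left x hx).neg
  hasDerivAt_right x hx := (c.hasDerivAt_right x hx).neg
  tendsto_left := by simpa using c.tendsto_left.neg
  tendsto_right := by simpa using c.tendsto_right.neg
  nonneg_left x hx := by simpa using c.nonpos_left x hx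
  nonpos_left x hx := by simpa using c.nonneg_left x hx
  nonneg_right x hx := by simpa using c.nonpos_right x hx
  nonpos_right x hx := by simpa using c.nonneg_right x hx

theorem exists_nonneg (c : SignChain b h h' k k' H) {x₀ : ℝ} (hx₀ : x₀ ∈ Set.Ioo 0 b)
    (hn : 0 ≤ h x₀) : ∃ ξ ∈ Set.Ioo 0 x₀, 0 ≤ k ξ ∧ ∃ η ∈ Set.Ioo 0 ξ, 0 ≤ H η := by
  obtain ⟨ξ, hξ, h1⟩ := exists_deriv_nonneg c.hasDerivAt_left c.tendsto_left hx₀ hn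
  have hξb : ξ ∈ Set.Ioo 0 b := ⟨hξ.1, hξ.2.trans hx₀.2⟩
  rw [c.nonneg_left ξ hξb] at h1
  obtain ⟨η, hη, h2⟩ := exists_deriv_nonneg c.hasDerivAt_right c.tendsto_right hξb h1
  rw [c.nonneg_right η ⟨hη.1, hη.2.trans hξb.2⟩] at h2
  exact ⟨ξ, hξ, h1, η, hη, h2⟩

theorem neg_of_neg (c : SignChain b h h' k k' H) (hH : ∀ x ∈ Set.Ioo 0 b, H x < 0) :
    ∀ x ∈ Set.Ioo 0 b, h x < 0 := by
  intro x hx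
  by_contra! hn
  obtain ⟨ξ, hξ, -, η, hη, h2⟩ := c.exists_nonneg hx hn
  exact (hH η ⟨hη.1, hη.2.trans (hξ.2.trans hx.2)⟩).not_ge h2

theorem pos_of_pos (c : SignChain b h h' k k' H) (hH : ∀ x ∈ Set.Ioo 0 b, 0 < H x) :
    ∀ x ∈ Set.Ioo 0 b, 0 < h x := fun x hx => by
  simpa using c.neg.neg_of_neg (fun y hy => by simpa using hH y hy) x hx

/-- A negative limit would make H negative near 0, while `exists_nonneg` finds points arbitrarily
near 0 with H ≥ 0. -/
theorem limit_nonneg (c : SignChain b h h' k k' H) (hb : 0 < b) {δ : ℝ}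
    (hδ : Tendsto H (𝓝[>] 0) (𝓝 δ)) (hn : ∀ x ∈ Set.Ioo 0 b, 0 ≤ h x) : 0 ≤ δ := by
  by_contra! hneg
  obtain ⟨e, he, hsub⟩ := mem_nhdsGT_iff_exists_Ioo_subset.1 (hδ.eventually (gt_mem_nhds hneg))
  have he : 0 < e := he
  have hx : min e b / 2 ∈ Set.Ioo 0 b :=
    ⟨by positivity, by linarith [min_le_right e b, lt_min he hb]⟩
  obtain ⟨ξ, hξ, -, η, hη, h2⟩ := c.exists_nonneg hx (hn _ hx)
  have : H η < 0 := hsub ⟨hη.1, by linarith [hη.2, hξ.2, min_le_left e b, lt_min he hb]⟩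
  linarith

theorem limit_nonpos (c : SignChain b h h' k k' H) (hb : 0 < b) {δ : ℝ}
    (hδ : Tendsto H (𝓝[>] 0) (𝓝 δ)) (hn : ∀ x ∈ Set.Ioo 0 b, h x ≤ 0) : δ ≤ 0 := by
  simpa using c.neg.limit_nonneg hb hδ.neg fun x hx => by simpa using hn x hx

theorem strictMonoOn_Ico_of_pos {g g' : ℝ → ℝ} {a : ℝ} (ha : 0 < a)
    (hg : ∀ x ∈ Set.Ioo 0 b, HasDerivAt g (g' x) x) (hpos : ∀ x ∈ Set.Ioo a b, 0 < g' x) :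
    StrictMonoOn g (Set.Ico a b) := by
  refine strictMonoOn_of_deriv_pos (convex_Ico a b) (fun y hy =>
    (hg y ⟨ha.trans_le hy.1, hy.2⟩).continuousAt.continuousWithinAt) fun y hy => ?_
  rw [interior_Ico] at hy
  rw [(hg y ⟨ha.trans hy.1, hy.2⟩).deriv]
  exact hpos y hy

/-- If h(x) ≥ 0, then k(ξ) ≥ 0 and H(η) ≥ 0 for some η < ξ < x. Monotonicity keeps H positive after
η, hence k positive and h strictly increasing after ξ, so the limit of h at b would be positive. -/
theorem neg_of_strictMonoOn (c : SignChain b h h' k k' H) (hH : StrictMonoOn H (Set.Ioo 0 b))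
    {l : ℝ} (hl : Tendsto h (𝓝[<] b) (𝓝 l)) (hl0 : l ≤ 0) :
    ∀ x ∈ Set.Ioo 0 b, h x < 0 := by
  intro x hx
  by_contra! hn
  obtain ⟨ξ, hξ, hk, η, hη, h2⟩ := c.exists_nonneg hx hn
  have hξb : ξ < b := hξ.2.trans hx.2
  have hkm : StrictMonoOn k (Set.Ico η b) := by
    refine strictMonoOn_Ico_of_pos hη.1 c.hasDerivAt_right fun y hy => ?_
    have hy0 : y ∈ Set.Ioo 0 b := ⟨hη.1.trans hy.1, hy.2⟩
    have : 0 < H y := h2.trans_lt (hH ⟨hη.1, hη.2.trans hξb⟩ hy0 hy.1)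
    exact not_le.1 (mt (c.nonpos_right y hy0).1 this.not_ge)
  have hhm : StrictMonoOn h (Set.Ico ξ b) := by
    refine strictMonoOn_Ico_of_pos hξ.1 c.hasDerivAt_left fun y hy => ?_
    have hy0 : y ∈ Set.Ioo 0 b := ⟨hξ.1.trans hy.1, hy.2⟩
    have : 0 < k y := hk.trans_lt (hkm ⟨hη.2.le, hξb⟩ ⟨(hη.2.trans hy.1).le, hy.2⟩ hy.1)
    exact not_le.1 (mt (c.nonpos_left y hy0).1 this.not_ge)
  obtain ⟨z, hz1, hz2⟩ := exists_between hx.2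
  have hxm : x ∈ Set.Ico ξ b := ⟨hξ.2.le, hx.2⟩
  have hzm : z ∈ Set.Ico ξ b := ⟨(hξ.2.trans hz1).le, hz2⟩
  have h3 : h x < h z := hhm hxm hzm hz1
  have h4 : h z ≤ l := by
    refine ge_of_tendsto hl ?_
    filter_upwards [Ioo_mem_nhdsLT hz2] with y hy
    exact hhm.monotoneOn hzm ⟨hzm.1.trans hy.1.le, hy.2⟩ hy.1.le
  linarith

theorem pos_of_strictAntiOn (c : SignChain b h h' k k' H) (hH : StrictAntiOn H (Set.Ioo 0 b))
    {l : ℝ} (hl : Tendsto h (𝓝[<] b) (𝓝 l)) (hl0 : 0 ≤ l) :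
    ∀ x ∈ Set.Ioo 0 b, 0 < h x := fun x hx => by
  simpa using c.neg.neg_of_strictMonoOn hH.neg hl.neg (by simpa using hl0) x hx

end SignChain

/-! ### The function φ and its dependence on p -/

/-- `φ p u = ∫₀ᵘ exp (-p t) dt`, in closed form. -/
noncomputable def phi (p u : ℝ) : ℝ := if p = 0 then u else (1 - Real.exp (-(p * u))) / p

theorem hasDerivAt_phi (p u : ℝ) : HasDerivAt (phi p) (Real.exp (-(p * u))) u := by
  by_cases hp : p = 0
  · subst hp
    have : phi 0 = id := by funext u; simp [phi]
    rw [this]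
    simpa using hasDerivAt_id u
  · have e : phi p = fun u => (1 - Real.exp (-(p * u))) / p := by funext u; simp [phi, hp]
    rw [e]
    refine ((((hasDerivAt_id u).const_mul p).neg.exp.const_sub 1).div_const p).congr_deriv ?_
    simp only [id, Pi.neg_apply]
    field_simp

@[simp] theorem phi_zero_right (p : ℝ) : phi p 0 = 0 := by simp [phi]

theorem strictMono_phi (p : ℝ) : StrictMono (phi p) :=
  strictMono_of_deriv_pos fun u => by rw [(hasDerivAt_phi p u).deriv]; positivity

theorem continuous_phi (p : ℝ) : Continuous (phi p) :=
  continuous_iff_continuousAt.2 fun u => (hasDerivAt_phi p u).continuousAt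

theorem phi_pos {p u : ℝ} (hu : 0 < u) : 0 < phi p u := by
  simpa using strictMono_phi p hu

/-- The integrand e^(-pt) decreases in p for t > 0. -/
theorem strictAnti_phi_left {u : ℝ} (hu : 0 < u) : StrictAnti fun p => phi p u := by
  intro p q hpq
  have hm : StrictMonoOn (fun u => phi p u - phi q u) (Set.Ici 0) := by
    refine strictMonoOn_of_deriv_pos (convex_Ici 0)
      ((continuous_phi p).sub (continuous_phi q)).continuousOn fun y hy => ?_
    rw [interior_Ici] at hy
    have hy : 0 < y := hy
    rw [((hasDerivAt_phi p y).fun_sub (hasDerivAt_phi q y)).deriv, sub_pos, Real.exp_lt_exp]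
    nlinarith
  have := hm Set.self_mem_Ici (Set.mem_Ici.2 hu.le) hu
  simp only [phi_zero_right, sub_self] at this
  simpa using this

/-- In p, φ is the difference quotient of 1 - e^(-pu) at 0, and the value u at p = 0 is the
derivative there. -/
theorem continuous_phi_left (u : ℝ) : Continuous fun p => phi p u := by
  have hd : ∀ p, HasDerivAt (fun p : ℝ => 1 - Real.exp (-(p * u))) (u * Real.exp (-(p * u))) p := by
    intro p
    refine (((hasDerivAt_id p).mul_const u).neg.exp.const_sub 1).congr_deriv ?_
    simp only [id, Pi.neg_apply]
    ring_nf
  have e : (fun p => phi p u) = dslope (fun p : ℝ => 1 - Real.exp (-(p * u))) 0 := by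
    funext p
    by_cases hp : p = 0
    · subst hp
      rw [dslope_same, (hd 0).deriv]
      simp [phi]
    · rw [dslope_of_ne _ hp, slope_def_field]
      simp [phi, hp]
  rw [e, continuous_iff_continuousAt]
  intro p
  by_cases hp : p = 0
  · subst hp
    exact continuousAt_dslope_same.2 (hd 0).differentiableAt
  · exact (continuousAt_dslope_of_ne hp).2 (hd p).continuousAt

theorem exists_phi_eq {u y : ℝ} (hu : 0 < u) (hy : 0 < y) : ∃ p, phi p u = y := by
  -- For p > 0, φ < 1/p, so p = 1/y gives a value below y. For p = -P, the bound e^(Pu) - 1 ≥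
  -- (Pu)²/2 gives φ ≥ Pu²/2, which is y for the second witness.
  refine mem_range_of_exists_le_of_exists_ge (continuous_phi_left u) ⟨1 / y, ?_⟩ ⟨-(2 * y / u ^ 2), ?_⟩
  · rw [phi, if_neg (by positivity)]
    rw [div_le_iff₀ (by positivity), mul_one_div_cancel hy.ne']
    linarith [Real.exp_pos (-(1 / y * u))]
  · have hP : 0 < 2 * y / u ^ 2 := by positivity
    set P := 2 * y / u ^ 2 with hPdef
    rw [phi, if_neg (by linarith)]
    have h1 := Real.quadratic_le_exp_of_nonneg (by positivity : 0 ≤ P * u)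
    rw [show -(-P * u) = P * u by ring, div_neg, ← neg_div, le_div_iff₀ hP]
    have h2 : (P * u) ^ 2 / 2 = y * P := by rw [hPdef]; field_simp
    have : 0 ≤ P * u := by positivity
    linarith

/-! ### Logarithmic variables and the sign chain of the gap -/

/-- `-ln (sin x / x)`. -/
noncomputable def logSinc (x : ℝ) : ℝ := -Real.log (Real.sin x / x)

/-- `-ln (cos x)`. -/
noncomputable def logCos (x : ℝ) : ℝ := -Real.log (Real.cos x)

theorem sin_div_mem {x : ℝ} (hx : x ∈ Set.Ioo 0 (Real.pi / 2)) :
    0 < Real.sin x / x ∧ Real.sin x / x < 1 :=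
  ⟨div_pos (sin_pos_of_mem hx) hx.1, (div_lt_one hx.1).2 (Real.sin_lt hx.1)⟩

theorem cos_lt_one_of_mem {x : ℝ} (hx : x ∈ Set.Ioo 0 (Real.pi / 2)) : Real.cos x < 1 := by
  have h1 := Real.sin_sq_add_cos_sq x
  have h2 := sin_pos_of_mem hx
  have h3 := cos_pos_of_mem hx
  nlinarith

theorem logCos_pos {x : ℝ} (hx : x ∈ Set.Ioo 0 (Real.pi / 2)) : 0 < logCos x :=
  neg_pos.2 (Real.log_neg (cos_pos_of_mem hx) (cos_lt_one_of_mem hx))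

theorem phi_neg_log {p y : ℝ} (hy : 0 < y) :
    phi p (-Real.log y) = if p = 0 then -Real.log y else (1 - y ^ p) / p := by
  rw [phi, Real.rpow_def_of_pos hy]
  congr 5
  ring

theorem S_eq_phi {p x : ℝ} (hx : x ∈ Set.Ioo 0 (Real.pi / 2)) : S p x = phi p (logSinc x) :=
  (phi_neg_log (sin_div_mem hx).1).symm

theorem C_eq_phi {q x : ℝ} (hx : x ∈ Set.Ioo 0 (Real.pi / 2)) : C q x = phi q (logCos x) :=
  (phi_neg_log (cos_pos_of_mem hx)).symm

/-- `3 S_p(x) - C_q(x)`, which has the sign of `D_{p,q}(x)`. -/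
noncomputable def gap (p q x : ℝ) : ℝ := 3 * phi p (logSinc x) - phi q (logCos x)

theorem hasDerivAt_logSinc {x : ℝ} (hx : x ∈ Set.Ioo 0 (Real.pi / 2)) :
    HasDerivAt logSinc (sinSubMulCos x / (x * Real.sin x)) x := by
  have hs := sin_pos_of_mem hx
  have hx0 := hx.1
  refine ((((Real.hasDerivAt_sin x).div (hasDerivAt_id x) hx0.ne').log
    (sin_div_mem hx).1.ne').neg).congr_deriv ?_
  simp only [id, sinSubMulCos, Pi.div_apply]
  field_simp
  ring

theorem hasDerivAt_logCos {x : ℝ} (hx : x ∈ Set.Ioo 0 (Real.pi / 2)) :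
    HasDerivAt logCos (Real.sin x / Real.cos x) x := by
  refine (((Real.hasDerivAt_cos x).log (cos_pos_of_mem hx).ne').neg).congr_deriv ?_
  ring

theorem tendsto_logSinc : Tendsto logSinc (𝓝[>] 0) (𝓝 0) := by
  have t := (tendsto_sin_div.log one_ne_zero).neg
  rwa [Real.log_one, neg_zero] at t

theorem tendsto_logCos : Tendsto logCos (𝓝[>] 0) (𝓝 0) := by
  have t := (tendsto_cos_zero.log one_ne_zero).neg
  rwa [Real.log_one, neg_zero] at t

/-- The logarithm of `3 S_p'(x) / C_q'(x)`. -/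
noncomputable def logSlope (p q x : ℝ) : ℝ :=
  Real.log 3 - Real.log (ratioA x) - p * logSinc x + q * logCos x

/-- The derivative of `logSlope` divided by the derivative of `logSinc`. -/
noncomputable def secondRatio (p q x : ℝ) : ℝ := -(p - 1) + (q - 1) * ratioA x + ratioB x

theorem ratioA_pos {x : ℝ} (hx : x ∈ Set.Ioo 0 (Real.pi / 2)) : 0 < ratioA x := by
  have := hx.1
  have := sin_pos_of_mem hx
  have := cos_pos_of_mem hx
  have := sinSubMulCos_pos hx
  unfold ratioA
  positivity

theorem hasDerivAt_logSlope (p q : ℝ) {x : ℝ} (hx : x ∈ Set.Ioo 0 (Real.pi / 2)) :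
    HasDerivAt (logSlope p q) (sinSubMulCos x / (x * Real.sin x) * secondRatio p q x) x := by
  have hx0 := hx.1
  have hs := sin_pos_of_mem hx
  have hc := cos_pos_of_mem hx
  have hw := sinSubMulCos_pos hx
  refine (((((hasDerivAt_ratioA hx).log (ratioA_pos hx).ne').const_sub (Real.log 3)).sub
    ((hasDerivAt_logSinc hx).const_mul p)).add
    ((hasDerivAt_logCos hx).const_mul q)).congr_deriv ?_
  have h := Real.sin_sq_add_cos_sq x
  have e : -(Real.sin x * (Real.sin x ^ 2 * Real.cos x + x * Real.sin x
      - 2 * x ^ 2 * Real.cos x) / (Real.cos x ^ 2 * sinSubMulCos x ^ 2) / ratioA x) =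
      sinSubMulCos x / (x * Real.sin x) * (1 - ratioA x + ratioB x) := by
    unfold ratioA ratioB
    field_simp
    unfold sinSubMulCos
    linear_combination (x * Real.sin x - x ^ 2 * Real.cos x) * h
  have e2 : Real.sin x / Real.cos x = sinSubMulCos x / (x * Real.sin x) * ratioA x := by
    unfold ratioA
    field_simp
  rw [e, e2, secondRatio]
  ring

theorem signChain_gap (p q : ℝ) :
    SignChain (Real.pi / 2) (gap p q)
      (fun x => 3 * (Real.exp (-(p * logSinc x)) * (sinSubMulCos x / (x * Real.sin x)))
        - Real.exp (-(q * logCos x)) * (Real.sin x / Real.cos x))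
      (logSlope p q) (fun x => sinSubMulCos x / (x * Real.sin x) * secondRatio p q x)
      (secondRatio p q) := by
  have hpos : ∀ x ∈ Set.Ioo 0 (Real.pi / 2), 0 < sinSubMulCos x / (x * Real.sin x) :=
    fun x hx => div_pos (sinSubMulCos_pos hx) (mul_pos hx.1 (sin_pos_of_mem hx))
  -- The derivative of the gap is C_q' (3S_p'/C_q' - 1) with C_q' > 0, so its sign is that of the
  -- logarithm of the quotient.
  have hfac : ∀ x ∈ Set.Ioo 0 (Real.pi / 2),
      3 * (Real.exp (-(p * logSinc x)) * (sinSubMulCos x / (x * Real.sin x)))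
        - Real.exp (-(q * logCos x)) * (Real.sin x / Real.cos x) =
      Real.exp (-(q * logCos x)) * (Real.sin x / Real.cos x) *
        (Real.exp (logSlope p q x) - 1) := by
    intro x hx
    have hx0 := hx.1
    have hs := sin_pos_of_mem hx
    have hc := cos_pos_of_mem hx
    have hw := sinSubMulCos_pos hx
    have e : Real.exp (logSlope p q x) =
        3 / ratioA x * Real.exp (-(p * logSinc x)) * Real.exp (q * logCos x) := by
      rw [logSlope, Real.exp_add, sub_eq_add_neg, Real.exp_add, Real.exp_sub,
        Real.exp_log (by norm_num), Real.exp_log (ratioA_pos hx)]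
    rw [e, Real.exp_neg (q * logCos x), ratioA]
    field_simp
  have hm : ∀ x ∈ Set.Ioo 0 (Real.pi / 2),
      0 < Real.exp (-(q * logCos x)) * (Real.sin x / Real.cos x) := fun x hx =>
    mul_pos (Real.exp_pos _) (div_pos (sin_pos_of_mem hx) (cos_pos_of_mem hx))
  have hnonpos : ∀ {m a : ℝ}, 0 < m → (m * a ≤ 0 ↔ a ≤ 0) := fun {m a} h => by
    simpa using mul_le_mul_iff_of_pos_left (b := a) (c := 0) h
  refine ⟨fun x hx => ?_, fun x hx => hasDerivAt_logSlope p q hx, ?_, ?_, fun x hx => ?_,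
    fun x hx => ?_, fun x hx => mul_nonneg_iff_of_pos_left (hpos x hx), fun x hx => ?_⟩
  · exact ((((hasDerivAt_phi p _).comp x (hasDerivAt_logSinc hx)).const_mul 3).sub
      ((hasDerivAt_phi q _).comp x (hasDerivAt_logCos hx)))
  · have t1 := ((continuous_phi p).tendsto 0).comp tendsto_logSinc
    have t2 := ((continuous_phi q).tendsto 0).comp tendsto_logCos
    have t := (t1.const_mul 3).sub t2
    simp only [phi_zero_right, mul_zero, sub_zero] at t
    exact t
  · have t1 := (tendsto_ratioA.log (by norm_num)).const_sub (Real.log 3)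
    have t := (t1.sub (tendsto_logSinc.const_mul p)).add (tendsto_logCos.const_mul q)
    simp only [mul_zero, sub_self, add_zero] at t
    exact t
  · rw [hfac x hx, mul_nonneg_iff_of_pos_left (hm x hx), sub_nonneg, Real.one_le_exp_iff]
  · rw [hfac x hx, hnonpos (hm x hx), sub_nonpos, Real.exp_le_one_iff]
  · exact hnonpos (hpos x hx)

theorem tendsto_secondRatio (p q : ℝ) :
    Tendsto (secondRatio p q) (𝓝[>] 0) (𝓝 (3 * q - 8 / 5 - p)) := by
  have := ((tendsto_ratioA.const_mul (q - 1)).const_add (-(p - 1))).add tendsto_ratioB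
  rwa [show -(p - 1) + (q - 1) * 3 + 2 / 5 = 3 * q - 8 / 5 - p by ring] at this

theorem strictMonoOn_secondRatio (p : ℝ) {q : ℝ} (hq : 1 ≤ q) :
    StrictMonoOn (secondRatio p q) (Set.Ioo 0 (Real.pi / 2)) := by
  intro x hx y hy hxy
  have h1 := strictMonoOn_ratioB hx hy hxy
  have h2 := mul_le_mul_of_nonneg_left (monotoneOn_ratioA hx hy hxy.le) (sub_nonneg.2 hq)
  unfold secondRatio
  linarith

/-- Write (q-1)A + B = -(A - 35B)/35 - (34/35 - q)A. -/
theorem strictAntiOn_secondRatio (p : ℝ) {q : ℝ} (hq : q ≤ 34 / 35) :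
    StrictAntiOn (secondRatio p q) (Set.Ioo 0 (Real.pi / 2)) := by
  intro x hx y hy hxy
  have h1 := strictMonoOn_ratioA_sub_ratioB hx hy hxy
  have h2 := mul_le_mul_of_nonneg_left (monotoneOn_ratioA hx hy hxy.le) (sub_nonneg.2 hq)
  unfold secondRatio
  linarith

/-! ### Translating bounds by M into signs of the gap -/

theorem M_spec {p q x : ℝ} (hx : x ∈ Set.Ioo 0 (Real.pi / 2)) (hE : (p, q) ∈ E) :
    0 < M (Real.cos x) p q ∧
      phi p (-Real.log (M (Real.cos x) p q)) = phi q (logCos x) / 3 := by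
  have hc := cos_pos_of_mem hx
  have hv : 0 < phi q (logCos x) := phi_pos (logCos_pos hx)
  by_cases hp : p = 0
  · subst hp
    rw [logCos, phi_neg_log hc, phi]
    by_cases hq : q = 0
    · simp only [M, hq, if_true, Real.log_rpow hc]
      exact ⟨by positivity, by ring⟩
    · simp only [M, hq, if_true, if_false, Real.log_exp]
      exact ⟨by positivity, by field_simp; ring⟩
  have hM : M (Real.cos x) p q = (1 - p * (phi q (logCos x) / 3)) ^ (1 / p) := by
    rw [logCos, phi_neg_log hc]
    by_cases hq : q = 0
    · simp only [M, hq, hp, if_true, if_false]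
      congr 1
      ring
    · simp only [M, hq, hp, if_false]
      congr 1
      field_simp
      ring
  -- Here E is needed: for p > 0, φ_q(v) < 1/q and p ≤ 3q keep the base of the power positive.
  have hb : 0 < 1 - p * (phi q (logCos x) / 3) := by
    rcases hE with h | ⟨h1, h2⟩
    · have h : p ≤ 0 := h
      nlinarith
    · have h1 : 0 < p := h1
      have h2 : p ≤ 3 * q := h2
      have hq : 0 < q := by linarith
      have h3 : phi q (logCos x) < 1 / q := by
        rw [logCos, phi_neg_log hc, if_neg hq.ne', div_lt_div_iff_of_pos_right hq]
        linarith [Real.rpow_pos_of_pos hc q]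
      rw [lt_div_iff₀ hq] at h3
      nlinarith
  rw [hM]
  refine ⟨by positivity, ?_⟩
  rw [phi_neg_log (by positivity), if_neg hp, ← Real.rpow_mul hb.le, one_div_mul_cancel hp,
    Real.rpow_one]
  field_simp
  ring

theorem M_lt_iff {p q x : ℝ} (hx : x ∈ Set.Ioo 0 (Real.pi / 2)) (hE : (p, q) ∈ E) :
    M (Real.cos x) p q < Real.sin x / x ↔ gap p q x < 0 := by
  obtain ⟨h0, h⟩ := M_spec hx hE
  rw [← Real.log_lt_log_iff h0 (sin_div_mem hx).1, ← neg_lt_neg_iff,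
    ← (strictMono_phi p).lt_iff_lt, h, gap, logSinc]
  constructor <;> intro <;> linarith

theorem lt_M_iff {p q x : ℝ} (hx : x ∈ Set.Ioo 0 (Real.pi / 2)) (hE : (p, q) ∈ E) :
    Real.sin x / x < M (Real.cos x) p q ↔ 0 < gap p q x := by
  obtain ⟨h0, h⟩ := M_spec hx hE
  rw [← Real.log_lt_log_iff (sin_div_mem hx).1 h0, ← neg_lt_neg_iff,
    ← (strictMono_phi p).lt_iff_lt, h, gap, logSinc]
  constructor <;> intro <;> linarith

/-! ### The endpoint π/2 and the root p(q) -/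

theorem log_pi_div_two_pos : 0 < -Real.log (2 / Real.pi) := by
  refine neg_pos.2 (Real.log_neg (by positivity) ?_)
  rw [div_lt_one Real.pi_pos]
  linarith [Real.pi_gt_three]

theorem tendsto_phi_logSinc (p : ℝ) :
    Tendsto (fun x => phi p (logSinc x)) (𝓝[<] (Real.pi / 2))
      (𝓝 (phi p (-Real.log (2 / Real.pi)))) := by
  have hp := Real.pi_pos
  have h1 : ContinuousAt (fun x => Real.sin x / x) (Real.pi / 2) :=
    Real.continuous_sin.continuousAt.div continuousAt_id (by positivity)
  have e : Real.sin (Real.pi / 2) / (Real.pi / 2) = 2 / Real.pi := by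
    rw [Real.sin_pi_div_two]
    field_simp
  have h2 := ((h1.log (by rw [e]; positivity)).neg).tendsto.mono_left
    (nhdsWithin_le_nhds (s := Set.Iio (Real.pi / 2)))
  simp only [Pi.neg_apply, e] at h2
  exact ((continuous_phi p).tendsto _).comp h2

theorem Ioo_mem_nhdsLT_pi_div_two : Set.Ioo 0 (Real.pi / 2) ∈ 𝓝[<] (Real.pi / 2) :=
  Ioo_mem_nhdsLT (by positivity)

theorem tendsto_phi_logCos {q : ℝ} (hq : 0 < q) :
    Tendsto (fun x => phi q (logCos x)) (𝓝[<] (Real.pi / 2)) (𝓝 (1 / q)) := by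
  have h1 : Tendsto (fun x => (1 - Real.cos x ^ q) / q) (𝓝[<] (Real.pi / 2)) (𝓝 (1 / q)) := by
    have hc : Continuous fun x => (1 - Real.cos x ^ q) / q :=
      (continuous_const.sub (Real.continuous_cos.rpow_const fun _ => Or.inr hq.le)).div_const q
    refine (hc.tendsto' _ _ ?_).mono_left nhdsWithin_le_nhds
    simp [Real.zero_rpow hq.ne']
  refine h1.congr' ?_
  filter_upwards [Ioo_mem_nhdsLT_pi_div_two] with x hx
  rw [logCos, phi_neg_log (cos_pos_of_mem hx), if_neg hq.ne']

theorem tendsto_gap (p : ℝ) {q : ℝ} (hq : 0 < q) :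
    Tendsto (gap p q) (𝓝[<] (Real.pi / 2))
      (𝓝 (3 * phi p (-Real.log (2 / Real.pi)) - 1 / q)) :=
  ((tendsto_phi_logSinc p).const_mul 3).sub (tendsto_phi_logCos hq)

/-- At π/2⁻, S_p tends to φ_p(ln(π/2)) and C_q to 1/q, so the root equation is explicit in φ. -/
theorem isRoot_iff {p q : ℝ} (hq : 0 < q) :
    IsRoot p q ↔ phi p (-Real.log (2 / Real.pi)) = 1 / (3 * q) := by
  have hD : Tendsto (D p q) (𝓝[<] (Real.pi / 2))
      (𝓝 (phi p (-Real.log (2 / Real.pi)) / (1 / q) - 1 / 3)) := by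
    refine (((tendsto_phi_logSinc p).div (tendsto_phi_logCos hq) (by positivity)).sub_const
      (1 / 3)).congr' ?_
    filter_upwards [Ioo_mem_nhdsLT_pi_div_two] with x hx
    simp only [D, S_eq_phi hx, C_eq_phi hx, Pi.div_apply]
  have e : phi p (-Real.log (2 / Real.pi)) = 1 / (3 * q) ↔
      phi p (-Real.log (2 / Real.pi)) / (1 / q) - 1 / 3 = 0 := by
    rw [sub_eq_zero]
    field_simp
  rw [e]
  exact ⟨fun h => tendsto_nhds_unique hD h, fun h => by rwa [h] at hD⟩

theorem isRoot_pOf {q : ℝ} (hq : 0 < q) : IsRoot (pOf q) q := by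
  obtain ⟨p, hp⟩ := exists_phi_eq log_pi_div_two_pos (by positivity : 0 < 1 / (3 * q))
  exact Classical.epsilon_spec (p := fun p => IsRoot p q) ⟨p, (isRoot_iff hq).2 hp⟩

theorem phi_pOf {q : ℝ} (hq : 0 < q) : phi (pOf q) (-Real.log (2 / Real.pi)) = 1 / (3 * q) :=
  (isRoot_iff hq).1 (isRoot_pOf hq)

theorem isRoot_iff_eq_pOf {p q : ℝ} (hq : 0 < q) : IsRoot p q ↔ p = pOf q := by
  rw [isRoot_iff hq, ← phi_pOf hq]
  exact (strictAnti_phi_left log_pi_div_two_pos).injective.eq_iff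

theorem qOf_eq (p : ℝ) : qOf p = 1 / (3 * phi p (-Real.log (2 / Real.pi))) := by
  rw [phi_neg_log (by positivity), qOf]
  by_cases hp : p = 0
  · simp only [hp, if_true]
    rw [mul_neg, div_neg, neg_div]
  · simp only [hp, if_false]
    rw [← mul_div_assoc, one_div_div]

theorem qOf_pos (p : ℝ) : 0 < qOf p := by
  have := phi_pos (p := p) log_pi_div_two_pos
  rw [qOf_eq]
  positivity

theorem pOf_qOf (p : ℝ) : pOf (qOf p) = p := by
  symm
  rw [← isRoot_iff_eq_pOf (qOf_pos p), isRoot_iff (qOf_pos p), qOf_eq]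
  have := phi_pos (p := p) log_pi_div_two_pos
  field_simp

theorem qOf_pOf {q : ℝ} (hq : 0 < q) : qOf (pOf q) = q := by
  rw [qOf_eq, phi_pOf hq]
  field_simp

theorem gap_limit_eq (p : ℝ) {q : ℝ} (hq : 0 < q) :
    3 * phi p (-Real.log (2 / Real.pi)) - 1 / q =
      3 * (phi p (-Real.log (2 / Real.pi)) - phi (pOf q) (-Real.log (2 / Real.pi))) := by
  rw [phi_pOf hq]
  field_simp

theorem gap_limit_nonpos_iff {p q : ℝ} (hq : 0 < q) :
    3 * phi p (-Real.log (2 / Real.pi)) - 1 / q ≤ 0 ↔ pOf q ≤ p := by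
  rw [← (strictAnti_phi_left log_pi_div_two_pos).le_iff_ge (a := p), gap_limit_eq p hq]
  constructor <;> intro <;> linarith

theorem gap_limit_nonneg_iff {p q : ℝ} (hq : 0 < q) :
    0 ≤ 3 * phi p (-Real.log (2 / Real.pi)) - 1 / q ↔ p ≤ pOf q := by
  rw [← (strictAnti_phi_left log_pi_div_two_pos).le_iff_ge (a := pOf q), gap_limit_eq p hq]
  constructor <;> intro <;> linarith

/-! ### Sharp criteria for the sign of the gap -/

theorem lt_of_tendsto_of_strictMonoOn {f : ℝ → ℝ} {b l x : ℝ} (hf : StrictMonoOn f (Set.Ioo 0 b))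
    (hl : Tendsto f (𝓝[>] 0) (𝓝 l)) (hx : x ∈ Set.Ioo 0 b) : l < f x := by
  have hm : x / 2 ∈ Set.Ioo 0 b := ⟨half_pos hx.1, by linarith [hx.1, hx.2]⟩
  refine (le_of_tendsto hl ?_).trans_lt (hf hm hx (half_lt_self hx.1))
  filter_upwards [Ioo_mem_nhdsGT hm.1] with y hy
  exact hf.monotoneOn ⟨hy.1, hy.2.trans hm.2⟩ hm hy.2.le

theorem gap_pos_iff_of_one_le {p q : ℝ} (hq : 1 ≤ q) :
    (∀ x ∈ Set.Ioo 0 (Real.pi / 2), 0 < gap p q x) ↔ p ≤ 3 * q - 8 / 5 := by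
  constructor
  · intro h
    linarith [(signChain_gap p q).limit_nonneg (by positivity) (tendsto_secondRatio p q)
      fun x hx => (h x hx).le]
  · intro h
    refine (signChain_gap p q).pos_of_pos fun x hx => ?_
    linarith [lt_of_tendsto_of_strictMonoOn (strictMonoOn_secondRatio p hq)
      (tendsto_secondRatio p q) hx]

theorem gap_neg_iff_of_le {p q : ℝ} (hq : q ≤ 34 / 35) :
    (∀ x ∈ Set.Ioo 0 (Real.pi / 2), gap p q x < 0) ↔ 3 * q - 8 / 5 ≤ p := by
  constructor
  · intro h
    linarith [(signChain_gap p q).limit_nonpos (by positivity) (tendsto_secondRatio p q)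
      fun x hx => (h x hx).le]
  · intro h
    refine (signChain_gap p q).neg_of_neg fun x hx => ?_
    linarith [lt_of_tendsto_of_strictMonoOn (strictAntiOn_secondRatio p hq).neg
      (tendsto_secondRatio p q).neg hx]

/-- The endpoint limit is necessary by passage to the limit, and sufficient because `secondRatio` is
increasing. -/
theorem gap_neg_iff_of_one_le {p q : ℝ} (hq : 1 ≤ q) :
    (∀ x ∈ Set.Ioo 0 (Real.pi / 2), gap p q x < 0) ↔ pOf q ≤ p := by
  have hq0 : 0 < q := by linarith
  rw [← gap_limit_nonpos_iff hq0]
  constructor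
  · intro h
    refine le_of_tendsto (tendsto_gap p hq0) ?_
    filter_upwards [Ioo_mem_nhdsLT_pi_div_two] with x hx using (h x hx).le
  · exact (signChain_gap p q).neg_of_strictMonoOn (strictMonoOn_secondRatio p hq)
      (tendsto_gap p hq0)

theorem gap_pos_iff_of_le {p q : ℝ} (hq0 : 0 < q) (hq : q ≤ 34 / 35) :
    (∀ x ∈ Set.Ioo 0 (Real.pi / 2), 0 < gap p q x) ↔ p ≤ pOf q := by
  rw [← gap_limit_nonneg_iff hq0]
  constructor
  · intro h
    refine ge_of_tendsto (tendsto_gap p hq0) ?_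
    filter_upwards [Ioo_mem_nhdsLT_pi_div_two] with x hx using (h x hx).le
  · exact (signChain_gap p q).pos_of_strictAntiOn (strictAntiOn_secondRatio p hq)
      (tendsto_gap p hq0)

theorem forall_M_lt_iff {p q : ℝ} (hE : (p, q) ∈ E) :
    (∀ x ∈ Set.Ioo 0 (Real.pi / 2), M (Real.cos x) p q < Real.sin x / x) ↔
      ∀ x ∈ Set.Ioo 0 (Real.pi / 2), gap p q x < 0 :=
  forall₂_congr fun _ hx => M_lt_iff hx hE

theorem forall_lt_M_iff {p q : ℝ} (hE : (p, q) ∈ E) :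
    (∀ x ∈ Set.Ioo 0 (Real.pi / 2), Real.sin x / x < M (Real.cos x) p q) ↔
      ∀ x ∈ Set.Ioo 0 (Real.pi / 2), 0 < gap p q x :=
  forall₂_congr fun _ hx => lt_M_iff hx hE

end SincBounds

theorem mainTheorem2 :
    -- for `q > 0`, `p(q)` is the unique root of `D_{p,q}(π/2⁻) = 0`
    (∀ q : ℝ, 0 < q → ∀ p : ℝ, SincBounds.IsRoot p q ↔ p = SincBounds.pOf q) ∧
    -- `q ↦ p(q)` on `(0, ∞)` is the inverse function of `p ↦ q(p)` on `ℝ`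
    (∀ p : ℝ, 0 < SincBounds.qOf p ∧ SincBounds.pOf (SincBounds.qOf p) = p) ∧
    (∀ q : ℝ, 0 < q → SincBounds.qOf (SincBounds.pOf q) = q) ∧
    -- (i)
    (∀ q p₁ p₂ : ℝ, 1 ≤ q → (p₁, q) ∈ SincBounds.E → (p₂, q) ∈ SincBounds.E →
      ((∀ x ∈ Set.Ioo (0 : ℝ) (Real.pi / 2),
          SincBounds.M (Real.cos x) p₁ q < Real.sin x / x ∧
            Real.sin x / x < SincBounds.M (Real.cos x) p₂ q) ↔
        SincBounds.pOf q ≤ p₁ ∧ p₂ ≤ 3 * q - 8 / 5)) ∧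
    -- (ii)
    (∀ q p₁ p₂ : ℝ, 0 < q → q ≤ 34 / 35 → (p₁, q) ∈ SincBounds.E → (p₂, q) ∈ SincBounds.E →
      ((∀ x ∈ Set.Ioo (0 : ℝ) (Real.pi / 2),
          SincBounds.M (Real.cos x) p₁ q < Real.sin x / x ∧
            Real.sin x / x < SincBounds.M (Real.cos x) p₂ q) ↔
        3 * q - 8 / 5 ≤ p₁ ∧ p₂ ≤ SincBounds.pOf q)) ∧
    -- (iii)
    (∀ q p₁ : ℝ, q ≤ 0 → (p₁, q) ∈ SincBounds.E →
      ((∀ x ∈ Set.Ioo (0 : ℝ) (Real.pi / 2),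
          SincBounds.M (Real.cos x) p₁ q < Real.sin x / x) ↔
        3 * q - 8 / 5 ≤ p₁)) := by
  refine ⟨fun q hq p => SincBounds.isRoot_iff_eq_pOf hq,
    fun p => ⟨SincBounds.qOf_pos p, SincBounds.pOf_qOf p⟩, fun q hq => SincBounds.qOf_pOf hq,
    fun q p₁ p₂ hq h1 h2 => ?_, fun q p₁ p₂ hq0 hq h1 h2 => ?_, fun q p₁ hq h1 => ?_⟩
  · simp only [forall_and]
    rw [SincBounds.forall_M_lt_iff h1, SincBounds.forall_lt_M_iff h2,
      SincBounds.gap_neg_iff_of_one_le hq, SincBounds.gap_pos_iff_of_one_le hq]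
  · simp only [forall_and]
    rw [SincBounds.forall_M_lt_iff h1, SincBounds.forall_lt_M_iff h2,
      SincBounds.gap_neg_iff_of_le hq, SincBounds.gap_pos_iff_of_le hq0 hq]
  · rw [SincBounds.forall_M_lt_iff h1, SincBounds.gap_neg_iff_of_le (by linarith)]
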